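/- Let $n$ be a natural number, let $[n]=\{1,\dots,n\}$, and let $g:[n]\to[n]$ be a function without fixed points. For a metric space $(X,d)$, say that $g$ is \emph{max-realizable in} $(X,d)$ if there are points $A_1,\dots,A_n\in X$ such that the distances $d(A_i,A_j)$ are distinct for different two-element sets $\{i,j\}\subseteq[n]$, and $d(A_i,A_{g(i)})\ge d(A_i,A_j)$ for all distinct $i,j\in[n]$. Say that $g$ is \emph{max-realizable} if it is max-realizable in some metric space. \textbf{Theorem.} Every max-realizable function $g:[n]\to[n]$ is max-realizable in the plane $\mathbb{R}^2$ with the Euclidean distance. -/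

import Mathlib

/-- A function `g : [n] → [n]` without fixed points is max-realizable in the metric space `X` if
there are points `A 1, …, A n` of `X` whose distances are distinct for different two-element
subsets `{i, j}` of the index set, such that `A (g i)` is a farthest point from `A i` for
every `i`. -/
structure MaxRealizableIn (X : Type*) [MetricSpace X] {n : ℕ} (g : Fin n → Fin n) : Prop where
  no_fixed_point : ∀ i, g i ≠ i
  exists_points : ∃ A : Fin n → X,
    (∀ i j k l, i ≠ j → k ≠ l → s(i, j) ≠ s(k, l) → dist (A i) (A j) ≠ dist (A k) (A l)) ∧
    ∀ i j, i ≠ j → dist (A i) (A j) ≤ dist (A i) (A (g i))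

universe u

/-- `g` is max-realizable if it is max-realizable in some metric space (in an arbitrary universe). -/
def MaxRealizable {n : ℕ} (g : Fin n → Fin n) : Prop :=
  ∃ (X : Type u) (_ : MetricSpace X), MaxRealizableIn X g

/-! The distance to the farthest point strictly increases along `g` except on two-cycles, so every
orbit ends in a two-cycle. Colour indices alternately and order them so that `g` is monotone on each
colour (`exists_colouring_and_ordering`). Put the colours in two tiny clusters facing each other: at
second order, the farthest point from `j` is the line `P i + 2 * x i * X` highest at `X = x j`. An
upper envelope of lines realizes any monotone choice (`exists_heights`). A small perturbation
separates the distances. -/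

open Filter Topology Finset

/-! ### Combinatorics of functions all of whose cycles have length two -/

/-- If `r` is nondecreasing along `g`, with equality only on two-element cycles, then every point
reaches such a cycle after `n` steps. -/
theorem iterate_mem_two_cycle {n : ℕ} (g : Fin n → Fin n) (r : Fin n → ℝ)
    (hr : ∀ i, g (g i) ≠ i → r i < r (g i)) (i : Fin n) :
    g (g (g^[n] i)) = g^[n] i := by
  by_contra hne
  have hall : ∀ k ≤ n, g (g (g^[k] i)) ≠ g^[k] i := by
    intro k hk h
    apply hne
    have h2 : g^[n] i = g^[n - k] (g^[k] i) := by
      rw [← Function.iterate_add_apply, Nat.sub_add_cancel hk]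
    rw [h2, ← Function.iterate_succ_apply' g, ← Function.iterate_succ_apply' g,
      Function.iterate_succ_apply, Function.iterate_succ_apply, h]
  have hstep : ∀ k ≤ n, r (g^[k] i) < r (g^[k + 1] i) := by
    intro k hk
    rw [Function.iterate_succ_apply']
    exact hr _ (hall k hk)
  have hmono : StrictMono fun k : Fin (n + 1) => r (g^[k] i) := by
    rw [Fin.strictMono_iff_lt_succ]
    intro k
    simpa using hstep k k.2.le
  have hinj : Function.Injective fun k : Fin (n + 1) => g^[k] i :=
    fun a b hab => hmono.injective (congrArg r hab)
  simpa using Fintype.card_le_of_injective _ hinj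

/-- The number whose base `n` digits are `i, g i, g (g i), …`, the first `m` of them. -/
def orbitCode {n : ℕ} (g : Fin n → Fin n) : ℕ → Fin n → ℕ
  | 0, _ => 0
  | m + 1, i => n * orbitCode g m (g i) + i

theorem orbitCode_lt {n : ℕ} (g : Fin n → Fin n) (m : ℕ) (i : Fin n) :
    orbitCode g m i < n ^ m := by
  induction m generalizing i with
  | zero => simp [orbitCode]
  | succ m ih =>
    have h1 : n * (orbitCode g m (g i) + 1) ≤ n * n ^ m := Nat.mul_le_mul_left _ (ih (g i))
    have h2 := i.2
    rw [orbitCode, pow_succ']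
    linarith

/-- The far end of the orbit is the most significant digit. -/
theorem orbitCode_succ_eq_top {n : ℕ} (g : Fin n → Fin n) (m : ℕ) (i : Fin n) :
    orbitCode g (m + 1) i = n ^ m * (g^[m] i : ℕ) + orbitCode g m i := by
  induction m generalizing i with
  | zero => simp [orbitCode]
  | succ m ih =>
    rw [orbitCode, ih, Function.iterate_succ_apply, orbitCode, pow_succ']
    ring

/-- For digits `a, b < n`, the leading part of `n * x + a` is monotone. -/
theorem le_of_mul_add_le {n x y a b : ℕ} (hb : b < n) (h : n * x + a ≤ n * y + b) : x ≤ y := by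
  by_contra hlt
  have : n * (y + 1) ≤ n * x := Nat.mul_le_mul_left _ (by omega)
  linarith

/-- If every orbit of `g` ends in a two-element cycle, then the index set has a two-colouring
alternating along `g` and an ordering for which `g` is monotone on each colour class. -/
theorem exists_colouring_and_ordering {n : ℕ} (g : Fin n → Fin n) (hfix : ∀ i, g i ≠ i) (N : ℕ)
    (hN : ∀ i, g (g (g^[N] i)) = g^[N] i) :
    ∃ (c : Fin n → Bool) (K : Fin n → ℕ), (∀ i, c (g i) = !c i) ∧ Function.Injective K ∧
      ∀ i j, c i = c j → K i ≤ K j → K (g i) ≤ K (g j) := by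
  have hcomm : ∀ i, g^[N] (g i) = g (g^[N] i) := fun i => by
    rw [← Function.iterate_succ_apply, Function.iterate_succ_apply']
  -- `comp` names the terminal two-cycle by its smaller element; `c` records which of its elements
  -- is reached after `N` steps.
  let comp : Fin n → ℕ := fun i => min (g^[N] i : ℕ) (g (g^[N] i) : ℕ)
  let c : Fin n → Bool := fun i => decide ((g^[N] i : ℕ) < g (g^[N] i))
  have hcomp : ∀ i, comp (g i) = comp i := fun i => by
    simp only [comp, hcomm, hN, min_comm]
  have hc : ∀ i, c (g i) = !c i := fun i => by
    have h := hfix (g^[N] i)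
    simp only [c, hcomm, hN, ← decide_not, decide_eq_decide]
    rw [Ne, Fin.ext_iff] at h
    omega
  have hcycle : ∀ i j, c i = c j → comp i = comp j → g^[N] i = g^[N] j := fun i j h1 h2 => by
    simp only [c, comp, decide_eq_decide] at h1 h2
    by_cases h : (g^[N] i : ℕ) < g (g^[N] i)
    · have h' := h1.1 h
      exact Fin.ext (by omega)
    · have h' := mt h1.2 h
      have h3 : g (g^[N] i) = g (g^[N] j) := Fin.ext (by omega)
      rw [← hN i, h3, hN j]
  let D : Fin n → ℕ := orbitCode g (N + 1)
  refine ⟨c, fun i => n ^ (N + 1) * comp i + D i, hc, ?_, ?_⟩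
  · intro i j hij
    have hij : n ^ (N + 1) * comp i + D i = n ^ (N + 1) * comp j + D j := hij
    have h1 : comp i = comp j := le_antisymm
      (le_of_mul_add_le (orbitCode_lt g _ j) hij.le) (le_of_mul_add_le (orbitCode_lt g _ i) hij.ge)
    have h2 : D i = D j := by rw [h1] at hij; omega
    have h3 : n * orbitCode g N (g i) + i = n * orbitCode g N (g j) + j := h2
    have h4 := congrArg (· % n) h3
    simp only [Nat.mul_add_mod, Nat.mod_eq_of_lt (Fin.is_lt _)] at h4
    exact Fin.ext h4
  · intro i j hcij hij
    simp only [hcomp]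
    have hle : comp i ≤ comp j := le_of_mul_add_le (orbitCode_lt g _ j) hij
    rcases hle.lt_or_eq with hlt | heq
    · have h1 : n ^ (N + 1) * (comp i + 1) ≤ n ^ (N + 1) * comp j := Nat.mul_le_mul_left _ hlt
      have h2 := orbitCode_lt g (N + 1) (g i)
      change _ + orbitCode g (N + 1) (g i) ≤ _
      linarith [Nat.zero_le (D (g j))]
    · have h1 : n * orbitCode g N (g i) + i ≤ n * orbitCode g N (g j) + j := by
        have hij : n ^ (N + 1) * comp i + D i ≤ n ^ (N + 1) * comp j + D j := hij
        rw [heq] at hij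
        exact Nat.le_of_add_le_add_left hij
      -- Passing to `g i` drops the lowest digit and adds a top digit on the cycle, the same for `i`
      -- and `j` by `h3`.
      have h2 := le_of_mul_add_le j.2 h1
      have h3 := hcycle i j hcij heq
      rw [heq]
      change _ + orbitCode g (N + 1) (g i) ≤ _ + orbitCode g (N + 1) (g j)
      rw [orbitCode_succ_eq_top, orbitCode_succ_eq_top, hcomm, hcomm, h3]
      omega

/-! ### Heights -/

/-- A sum of terms that are positive before `m` and negative from `m` on has its strict maximum
at `m`. -/
theorem sum_range_lt_sum_range_of_sign {f : ℕ → ℝ} {m l : ℕ} (hpos : ∀ k < m, 0 < f k)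
    (hneg : ∀ k, m ≤ k → f k < 0) (hl : l ≠ m) :
    ∑ k ∈ range l, f k < ∑ k ∈ range m, f k := by
  rcases lt_or_gt_of_ne hl with h | h
  · rw [← sum_range_add_sum_Ico f h.le]
    have : 0 < ∑ k ∈ Ico l m, f k :=
      sum_pos (fun k hk => hpos k (mem_Ico.1 hk).2) (nonempty_Ico.2 h)
    linarith
  · rw [← sum_range_add_sum_Ico f h.le]
    have : ∑ k ∈ Ico m l, f k < 0 :=
      sum_neg (fun k hk => hneg k (mem_Ico.1 hk).1) (nonempty_Ico.2 h)
    linarith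

/-- If `g` is monotone on each colour class, then some heights `P` make `g j` the strict maximizer
of `P i + 2 * K i * K j` over the `i` of the colour opposite to that of `j`. -/
theorem exists_heights {n : ℕ} (g : Fin n → Fin n) (c : Fin n → Bool) (K : Fin n → ℕ)
    (hc : ∀ i, c (g i) = !c i) (hK : Function.Injective K)
    (hmono : ∀ i j, c i = c j → K i ≤ K j → K (g i) ≤ K (g j)) :
    ∃ P : Fin n → ℝ, ∀ j i, c i ≠ c j → i ≠ g j →
      P i + 2 * K i * K j < P (g j) + 2 * K (g j) * K j := by
  -- The lines of slopes `2k` and `2(k + 1)` cross at `T e k - 1/2`, just right of the last `K j -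
  -- 1/2 + 1/2 = K j` whose image has `K (g j) ≤ k`; the half prevents ties.
  let T : Bool → ℕ → ℕ := fun e k =>
    (univ.filter fun j => c j ≠ e ∧ K (g j) ≤ k).sup fun j => K j + 1
  let P : Fin n → ℝ := fun i => -2 * ∑ k ∈ range (K i), ((T (c i) k : ℝ) - 1 / 2)
  refine ⟨P, fun j i hci hi => ?_⟩
  have hval : ∀ i', c i' ≠ c j → P i' + 2 * K i' * K j =
      2 * ∑ k ∈ range (K i'), ((K j : ℝ) - (T (!c j) k - 1 / 2)) := by
    intro i' h
    have h' : c i' = !c j := by simpa [Bool.eq_not] using h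
    simp only [P, h', sum_sub_distrib, sum_const, card_range, nsmul_eq_mul]
    ring
  rw [hval i hci, hval (g j) (by simp [hc])]
  refine mul_lt_mul_of_pos_left (sum_range_lt_sum_range_of_sign ?_ ?_ (hK.ne hi)) two_pos
  · intro k hk
    have : T (!c j) k ≤ K j := by
      refine Finset.sup_le fun j' hj' => ?_
      simp only [mem_filter, mem_univ, true_and] at hj'
      by_contra hlt
      have := hmono j j' (by simpa using hj'.1.symm) (by omega)
      omega
    have : (T (!c j) k : ℝ) ≤ K j := by exact_mod_cast this
    linarith
  · intro k hk
    have : K j + 1 ≤ T (!c j) k :=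
      Finset.le_sup (f := fun j => K j + 1) (by simpa using hk)
    have : (K j + 1 : ℝ) ≤ T (!c j) k := by exact_mod_cast this
    linarith

/-! ### The points in the plane -/

theorem EuclideanSpace.dist_mk_two (a b c d : ℝ) :
    dist !₂[a, b] !₂[c, d] = √((a - c) ^ 2 + (b - d) ^ 2) := by
  simp [EuclideanSpace.dist_eq, Real.dist_eq, sq_abs]

/-- Points with prescribed unique farthest points exist in the plane: two thin clusters, facing
each other at distance about `1`. Distances are squared. -/
theorem exists_strict_farthest {n : ℕ} (g : Fin n → Fin n) (c : Fin n → Bool) (x P : Fin n → ℝ)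
    (hc : ∀ i, c (g i) = !c i)
    (hP : ∀ j i, c i ≠ c j → i ≠ g j →
      P i + 2 * x i * x j < P (g j) + 2 * x (g j) * x j) :
    ∃ u v : Fin n → ℝ, ∀ j i, i ≠ g j →
      (u j - u i) ^ 2 + (v j - v i) ^ 2 < (u j - u (g j)) ^ 2 + (v j - v (g j)) ^ 2 := by
  let σ : Fin n → ℝ := fun i => if c i then 1 else -1
  -- This `p` cancels the squares in `(x i + x j) ^ 2 + 2 * (p i + p j)`, the `s ^ 2` coefficient
  -- across clusters.
  let p : Fin n → ℝ := fun i => (P i - x i ^ 2) / 2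
  let u : ℝ → Fin n → ℝ := fun s i => σ i * (s * x i)
  let v : ℝ → Fin n → ℝ := fun s i => σ i * (1 / 2 + s ^ 2 * p i)
  let d : ℝ → Fin n → Fin n → ℝ := fun s j i => (u s j - u s i) ^ 2 + (v s j - v s i) ^ 2
  have hσ : ∀ i, σ i ^ 2 = 1 := fun i => by by_cases h : c i <;> simp [σ, h]
  have hopp : ∀ s i j, c i ≠ c j → d s j i =
      1 + s ^ 2 * (P i + 2 * x i * x j + P j) + s ^ 4 * (p i + p j) ^ 2 := by
    intro s i j h
    have : σ i = -σ j := by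
      cases hi : c i <;> cases hj : c j <;> simp_all [σ]
    simp only [d, u, v, this]
    have h1 := hσ j
    simp only [p]
    linear_combination (s ^ 2 * (x i + x j) ^ 2 + (1 + s ^ 2 * ((P i - x i ^ 2) / 2 +
      (P j - x j ^ 2) / 2)) ^ 2) * h1
  have hsame : ∀ s i j, c i = c j → d s j i =
      s ^ 2 * (x j - x i) ^ 2 + s ^ 4 * (p j - p i) ^ 2 := by
    intro s i j h
    have : σ i = σ j := by simp [σ, h]
    simp only [d, u, v, this]
    have h1 := hσ j
    linear_combination (s ^ 2 * (x j - x i) ^ 2 + s ^ 4 * (p j - p i) ^ 2) * h1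
  have hev : ∀ᶠ s in 𝓝[>] (0 : ℝ), ∀ j i, i ≠ g j → d s j i < d s j (g j) := by
    simp only [eventually_all]
    intro j i hi
    have hgj : c (g j) ≠ c j := by simp [hc]
    by_cases hcij : c i = c j
    · have hcont : Continuous fun s : ℝ => d s j (g j) - d s j i := by
        simp only [d, u, v]; fun_prop
      have h0 : 0 < d 0 j (g j) - d 0 j i := by
        rw [hopp _ _ _ hgj, hsame _ _ _ hcij]; norm_num
      filter_upwards [nhdsWithin_le_nhds (hcont.continuousAt.eventually (lt_mem_nhds h0))]
        with s hs
      linarith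
    -- `q s` is the difference of squared distances divided by `s ^ 2`.
    · let q : ℝ → ℝ := fun s => (P (g j) + 2 * x (g j) * x j) - (P i + 2 * x i * x j) +
        s ^ 2 * ((p (g j) + p j) ^ 2 - (p i + p j) ^ 2)
      have hcont : Continuous q := by simp only [q]; fun_prop
      have h0 : 0 < q 0 := by
        have := hP j i hcij hi
        simp only [q]
        linarith
      filter_upwards [nhdsWithin_le_nhds (hcont.continuousAt.eventually (lt_mem_nhds h0)),
        self_mem_nhdsWithin] with s hs hs0
      have h1 : 0 < s ^ 2 * q s := mul_pos (pow_pos hs0 2) hs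
      rw [hopp _ _ _ hgj, hopp _ _ _ hcij]
      simp only [q] at h1
      linarith
  obtain ⟨s, hs⟩ := hev.exists
  exact ⟨u s, v s, hs⟩

/-! ### Perturbation to distinct distances -/

/-- The larger exponent `b` is determined, since the sum is at least `3 ^ b` and below `3 ^ (b +
1)`. -/
theorem three_pow_add_three_pow_inj {a b c d : ℕ} (h : 3 ^ a + 3 ^ b = 3 ^ c + 3 ^ d) :
    (a = c ∧ b = d) ∨ (a = d ∧ b = c) := by
  have key : ∀ {a b c d : ℕ}, a ≤ b → 3 ^ a + 3 ^ b = 3 ^ c + 3 ^ d → d ≤ b := by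
    intro a b c d hab h
    by_contra hlt
    have h1 : 3 ^ (b + 1) ≤ 3 ^ d := Nat.pow_le_pow_right (by norm_num) (by omega)
    have h2 : 3 ^ a ≤ 3 ^ b := Nat.pow_le_pow_right (by norm_num) hab
    have h3 : 0 < 3 ^ b := by positivity
    have h4 : 0 < 3 ^ c := by positivity
    rw [pow_succ] at h1
    omega
  have main : ∀ {a b c d : ℕ}, a ≤ b → c ≤ d → 3 ^ a + 3 ^ b = 3 ^ c + 3 ^ d →
      a = c ∧ b = d := by
    intro a b c d hab hcd h
    obtain rfl : b = d := le_antisymm (key hcd h.symm) (key hab h)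
    exact ⟨Nat.pow_right_injective (by norm_num : 2 ≤ 3) (Nat.add_right_cancel h), rfl⟩
  rcases le_total a b with hab | hab <;> rcases le_total c d with hcd | hcd
  · exact .inl (main hab hcd h)
  · exact .inr (main hab hcd (by omega))
  · exact .inr (main hab hcd (by omega)).symm
  · exact .inl (main hab hcd (by omega)).symm

theorem three_pow_sub_sq_ne {n : ℕ} {i j k l : Fin n} (hkl : k ≠ l)
    (h : s(i, j) ≠ s(k, l)) :
    ((3 : ℝ) ^ (i : ℕ) - 3 ^ (j : ℕ)) ^ 2 ≠ (3 ^ (k : ℕ) - 3 ^ (l : ℕ)) ^ 2 := by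
  intro heq
  simp only [ne_eq, Sym2.eq_iff, Fin.ext_iff] at *
  rcases sq_eq_sq_iff_eq_or_eq_neg.1 heq with h1 | h1
  · have h2 : (3 : ℝ) ^ (i : ℕ) + 3 ^ (l : ℕ) = 3 ^ (k : ℕ) + 3 ^ (j : ℕ) := by linarith
    have := three_pow_add_three_pow_inj (by exact_mod_cast h2)
    omega
  · have h2 : (3 : ℝ) ^ (i : ℕ) + 3 ^ (k : ℕ) = 3 ^ (l : ℕ) + 3 ^ (j : ℕ) := by linarith
    have := three_pow_add_three_pow_inj (by exact_mod_cast h2)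
    omega

theorem eventually_quadratic_ne_zero (a b : ℝ) {e : ℝ} (he : e ≠ 0) :
    ∀ᶠ t in 𝓝[≠] (0 : ℝ), e * t ^ 2 + b * t + a ≠ 0 := by
  let p : Polynomial ℝ := .C e * .X ^ 2 + .C b * .X + .C a
  have hp : p ≠ 0 := fun h => he <| by
    simpa [p, Polynomial.coeff_X, Polynomial.coeff_C] using congrArg (Polynomial.coeff · 2) h
  refine nhdsNE_le_cofinite (0 : ℝ) ?_
  refine (Polynomial.finite_setOfPred_isRoot hp).subset fun t ht => ?_
  simpa [p, Polynomial.IsRoot] using ht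

/-- Points with strictly farthest points can be moved so that all distances become distinct. -/
theorem exists_distinct_dist {n : ℕ} (g : Fin n → Fin n) (u v : Fin n → ℝ)
    (h : ∀ j i, i ≠ g j →
      (u j - u i) ^ 2 + (v j - v i) ^ 2 < (u j - u (g j)) ^ 2 + (v j - v (g j)) ^ 2) :
    ∃ A : Fin n → EuclideanSpace ℝ (Fin 2),
      (∀ i j k l, i ≠ j → k ≠ l → s(i, j) ≠ s(k, l) → dist (A i) (A j) ≠ dist (A k) (A l)) ∧
      ∀ i j, i ≠ j → dist (A i) (A j) ≤ dist (A i) (A (g i)) := by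
  -- With shifts `3 ^ i`, the difference of two squared distances is a quadratic in `t` with nonzero
  -- leading coefficient, by `three_pow_sub_sq_ne`.
  let w : ℝ → Fin n → ℝ := fun t i => u i + t * 3 ^ (i : ℕ)
  let d : ℝ → Fin n → Fin n → ℝ := fun t i j => (w t i - w t j) ^ 2 + (v i - v j) ^ 2
  have hfar : ∀ᶠ t in 𝓝[≠] (0 : ℝ), ∀ j i, i ≠ g j → d t j i < d t j (g j) := by
    simp only [eventually_all]
    intro j i hi
    have h1 : Continuous fun t => d t j (g j) - d t j i := by simp only [d, w]; fun_prop
    have h0 : 0 < d 0 j (g j) - d 0 j i := by simpa [d, w] using h j i hi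
    filter_upwards [nhdsWithin_le_nhds (h1.continuousAt.eventually (lt_mem_nhds h0))] with t ht
    linarith
  have hne : ∀ᶠ t in 𝓝[≠] (0 : ℝ), ∀ i j k l, i ≠ j → k ≠ l → s(i, j) ≠ s(k, l) →
      d t i j ≠ d t k l := by
    simp only [eventually_all]
    intro i j k l _ hkl hs
    have he := sub_ne_zero.2 (three_pow_sub_sq_ne hkl hs)
    filter_upwards [eventually_quadratic_ne_zero
      ((u i - u j) ^ 2 + (v i - v j) ^ 2 - ((u k - u l) ^ 2 + (v k - v l) ^ 2))
      (2 * (u i - u j) * (3 ^ (i : ℕ) - 3 ^ (j : ℕ)) -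
        2 * (u k - u l) * (3 ^ (k : ℕ) - 3 ^ (l : ℕ))) he] with t ht heq
    apply ht
    simp only [d, w] at heq
    linear_combination heq
  obtain ⟨t, hft, hnt⟩ := (hfar.and hne).exists
  have hdist : ∀ i j, dist !₂[w t i, v i] !₂[w t j, v j] = √(d t i j) := fun i j =>
    EuclideanSpace.dist_mk_two _ _ _ _
  have hnonneg : ∀ i j, 0 ≤ d t i j := fun i j => by positivity
  refine ⟨fun i => !₂[w t i, v i], fun i j k l hij hkl hs => ?_, fun i j _ => ?_⟩
  · rw [hdist, hdist, Ne, Real.sqrt_inj (hnonneg _ _) (hnonneg _ _)]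
    exact hnt i j k l hij hkl hs
  · rw [hdist, hdist]
    by_cases hj : j = g i
    · rw [hj]
    · exact Real.sqrt_le_sqrt (hft i j hj).le

theorem theorem3 {n : ℕ} (g : Fin n → Fin n) (hg : MaxRealizable.{u} g) :
    MaxRealizableIn (EuclideanSpace ℝ (Fin 2)) g := by
  obtain ⟨X, _, hfix, A, hdist, hfar⟩ := hg
  refine ⟨hfix, ?_⟩
  have hcycle : ∀ i, g (g (g^[n] i)) = g^[n] i := by
    refine iterate_mem_two_cycle g (fun i => dist (A i) (A (g i))) fun i hi => ?_
    refine lt_of_le_of_ne ?_ (hdist _ _ _ _ (hfix i).symm (hfix (g i)).symm ?_)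
    · simpa only [dist_comm] using hfar (g i) i (hfix i)
    · simp only [ne_eq, Sym2.eq_iff]
      rintro (⟨h1, -⟩ | ⟨h1, -⟩)
      · exact hfix i h1.symm
      · exact hi h1.symm
  obtain ⟨c, K, hc, hK, hmono⟩ := exists_colouring_and_ordering g hfix n hcycle
  obtain ⟨P, hP⟩ := exists_heights g c K hc hK hmono
  obtain ⟨u, v, huv⟩ := exists_strict_farthest g c (fun i => (K i : ℝ)) P hc hP
  exact exists_distinct_dist g u v huv
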